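/- Let $\mathbb{F}$ be a division ring, $\sigma:\mathbb{F}\to\mathbb{F}^{n\times n}$ a ring morphism and $\delta:\mathbb{F}\to\mathbb{F}^n$ a $\sigma$-derivation (additive, with $\delta(ab)=\sigma(a)\delta(b)+\delta(a)b$). Let $R=\mathbb{F}[\mathbf{x};\sigma,\delta]$ be the free multivariate skew polynomial ring: the left $\mathbb{F}$-vector space whose basis is the free monoid $\mathcal{M}$ on $x_1,\dots,x_n$, with product given by appending monomials and $x_i a=\sum_j\sigma_{i,j}(a)x_j+\delta_i(a)$. For $\mathbf{a}\in\mathbb{F}^n$ and $F\in R$, $F(\mathbf{a})\in\mathbb{F}$ is the unique element with $F-F(\mathbf{a})$ in the left ideal $(x_1-a_1,\dots,x_n-a_n)$. For $\Omega\subseteq\mathbb{F}^n$ put $I(\Omega)=\{F\in R: F(\mathbf{a})=0\ \forall\mathbf{a}\in\Omega\}$ (a left ideal) and $\overline{\Omega}=\{\mathbf{a}: F(\mathbf{a})=0\ \forall F\in I(\Omega)\}$. The set $\Omega$ is P-closed if $\overline{\Omega}=\Omega$; it is then finitely generated if $\Omega=\overline{\mathcal{G}}$ for a finite $\mathcal{G}\subseteq\Omega$;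 a P-basis of $\Omega$ is a set $\mathcal{B}\subseteq\Omega$ with $\overline{\mathcal{B}}=\Omega$ and $\mathbf{b}\notin\overline{\mathcal{B}\setminus\{\mathbf{b}\}}$ for all $\mathbf{b}\in\mathcal{B}$; and $\mathrm{Rk}(\Omega)$ is the number of elements of a P-basis. For $\mathbf{a}\in\mathbb{F}^n$ let $\mathcal{D}_{\mathbf{a}}(\beta)=\sigma(\beta)\mathbf{a}+\delta(\beta)\in\mathbb{F}^n$, let $\mathcal{D}_{\mathbf{a}}^{\mathfrak{m}}:\mathbb{F}\to\mathbb{F}$ be given by $\mathcal{D}_{\mathbf{a}}^1=\mathrm{Id}$ and $\mathcal{D}_{\mathbf{a}}^{x_i\mathfrak{m}}=(\mathcal{D}_{\mathbf{a}})_i\circ\mathcal{D}_{\mathbf{a}}^{\mathfrak{m}}$, let $\mathbb{F}[\mathcal{D}_{\mathbf{a}}]$ be the left $\mathbb{F}$-span of the $\mathcal{D}_{\mathbf{a}}^{\mathfrak{m}}$, $\mathfrak{m}\in\mathcal{M}$, a ring under composition, and for $F=\sum F_{\mathfrak{m}}\mathfrak{m}\in R$ let $F^{\mathcal{D}_{\mathbf{a}}}=\sum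 F_{\mathfrak{m}}\mathcal{D}_{\mathbf{a}}^{\mathfrak{m}}$. For $\beta\neq0$ put $\mathbf{a}^\beta=\mathcal{D}_{\mathbf{a}}(\beta)\beta^{-1}$; let $\mathcal{C}(\mathbf{a})=\{\mathbf{a}^\beta:\beta\in\mathbb{F}^*\}$ be the conjugacy class of $\mathbf{a}$ and $K_{\mathbf{a}}=\{\beta\in\mathbb{F}:\mathcal{D}_{\mathbf{a}}(\beta)=\mathbf{a}\beta\}$ its centralizer, a division subring of $\mathbb{F}$. **Theorem.** Let $\Omega\subseteq\mathbb{F}^n$ be a finitely generated P-closed set, let $\mathbf{a}_1,\dots,\mathbf{a}_\ell\in\mathbb{F}^n$ be pairwise non-conjugate, and let $\Omega_i=\Omega\cap\mathcal{C}(\mathbf{a}_i)\neq\varnothing$, where $\Omega=\Omega_1\cup\dots\cup\Omega_\ell$. Let $\Omega_i^{\mathcal{D}}\subseteq\mathbb{F}$ be the right $K_{\mathbf{a}_i}$-subspace spanned by the $\beta\ne0$ with $\mathbf{a}_i^\beta\in\Omega_i$, and let $I(\Omega_i^{\mathcal{D}})$ be the left ideal of those elements of $\mathbb{F}[\mathcal{D}_{\mathbf{a}_i}]$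 that vanish on $\Omega_i^{\mathcal{D}}$. Then: 1. Each $\Omega_i$ is P-closed and finitely generated, $\Omega_i^{\mathcal{D}}$ is finite-dimensional over $K_{\mathbf{a}_i}$, and $\Omega_i=\{\mathbf{a}_i^\beta:\beta\in\Omega_i^{\mathcal{D}}\setminus\{0\}\}$. 2. The maps $$R/I(\Omega)\to\bigoplus_{i=1}^\ell R/I(\Omega_i)\to\bigoplus_{i=1}^\ell\mathbb{F}[\mathcal{D}_{\mathbf{a}_i}]/I(\Omega_i^{\mathcal{D}}),$$ $$F+I(\Omega)\mapsto(F+I(\Omega_i))_i,\qquad (F_i+I(\Omega_i))_i\mapsto(F_i^{\mathcal{D}_{\mathbf{a}_i}}+I(\Omega_i^{\mathcal{D}}))_i,$$ are well-defined isomorphisms of left $\mathbb{F}$-vector spaces and of left $R$-modules, where $F\in R$ acts on the $i$-th summand on the right as $F^{\mathcal{D}_{\mathbf{a}_i}}$. Moreover, $I(\Omega)$ is two-sided if and only if all $I(\Omega_i)$ are, and if and only if all $I(\Omega_i^{\mathcal{D}})$ are; in that case the quotients are rings and both maps are left $\mathbb{F}$-algebra isomorphisms (coordinatewise products on the direct sums),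 that is, left $\mathbb{F}$-linear ring isomorphisms. 3. $\Omega$ and every $\Omega_i$ have P-bases, all P-bases of each of them are finite of the same size, and for every $i$ $$\dim^L_{\mathbb{F}}\big(\mathbb{F}[\mathcal{D}_{\mathbf{a}_i}]/I(\Omega_i^{\mathcal{D}})\big)=\dim^R_{K_{\mathbf{a}_i}}(\Omega_i^{\mathcal{D}})=\mathrm{Rk}(\Omega_i).$$ In particular $$\sum_{i=1}^\ell\dim^L_{\mathbb{F}}\big(\mathbb{F}[\mathcal{D}_{\mathbf{a}_i}]/I(\Omega_i^{\mathcal{D}})\big)=\sum_{i=1}^\ell\dim^R_{K_{\mathbf{a}_i}}(\Omega_i^{\mathcal{D}})=\sum_{i=1}^\ell\mathrm{Rk}(\Omega_i)=\dim^L_{\mathbb{F}}\big(R/I(\Omega)\big)=\mathrm{Rk}(\Omega).$$ -/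

import Mathlib

universe u

namespace SkewPolys

noncomputable section

/-- A `σ`-derivation `δ : F → Fⁿ` for a ring morphism `σ : F → Fⁿˣⁿ`: an additive map with
`δ(ab) = σ(a) δ(b) + δ(a) b` (the elements of `Fⁿ` are column vectors). -/
structure SkewDerivation {F : Type u} [DivisionRing F] {n : ℕ}
    (σ : F →+* Matrix (Fin n) (Fin n) F) extends F →+ (Fin n → F) where
  leibniz' : ∀ a b : F,
    toFun (a * b) = Matrix.mulVec (σ a) (toFun b) + fun i => toFun a i * b

instance {F : Type u} [DivisionRing F] {n : ℕ} (σ : F →+* Matrix (Fin n) (Fin n) F) :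
    CoeFun (SkewDerivation σ) (fun _ => F → Fin n → F) where
  coe δ := δ.toAddMonoidHom

section Derivation

variable {F : Type u} [DivisionRing F] {n : ℕ} {σ : F →+* Matrix (Fin n) (Fin n) F}

theorem SkewDerivation.map_add (δ : SkewDerivation σ) (a b : F) : δ (a + b) = δ a + δ b :=
  δ.toAddMonoidHom.map_add a b

theorem SkewDerivation.map_zero (δ : SkewDerivation σ) : δ 0 = 0 :=
  δ.toAddMonoidHom.map_zero

theorem SkewDerivation.map_mul (δ : SkewDerivation σ) (a b : F) (i : Fin n) :
    δ (a * b) i = ∑ j, σ a i j * δ b j + δ a i * b :=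
  congrFun (δ.leibniz' a b) i

theorem SkewDerivation.map_one (δ : SkewDerivation σ) : δ 1 = 0 := by
  funext i
  have h := δ.map_mul 1 1 i
  simp [Matrix.one_apply] at h
  simpa using h

theorem map_mul_apply (σ : F →+* Matrix (Fin n) (Fin n) F) (a b : F) (i j : Fin n) :
    σ (a * b) i j = ∑ k, σ a i k * σ b k j := by
  rw [map_mul, Matrix.mul_apply]

/-- The free multivariate skew polynomial ring `F[x; σ, δ]`: as a left `F`-vector space it has
as basis the free monoid of the words in the letters `x₁, …, xₙ`. -/
def SkewPoly (σ : F →+* Matrix (Fin n) (Fin n) F) (_δ : SkewDerivation σ) : Type u :=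
  FreeMonoid (Fin n) →₀ F

end Derivation

section Ring

variable {F : Type u} [DivisionRing F] {n : ℕ} {σ : F →+* Matrix (Fin n) (Fin n) F}
  {δ : SkewDerivation σ}

instance : AddCommGroup (SkewPoly σ δ) := inferInstanceAs (AddCommGroup (FreeMonoid (Fin n) →₀ F))

instance : Module F (SkewPoly σ δ) := inferInstanceAs (Module F (FreeMonoid (Fin n) →₀ F))

/-- The skew polynomial `c 𝔪` with one coefficient `c` at the monomial `𝔪`. -/
def term (δ : SkewDerivation σ) (m : FreeMonoid (Fin n)) (c : F) : SkewPoly σ δ :=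
  Finsupp.single m c

theorem term_add (m : FreeMonoid (Fin n)) (c d : F) :
    term δ m (c + d) = term δ m c + term δ m d := Finsupp.single_add m c d

theorem term_zero (m : FreeMonoid (Fin n)) : term δ m 0 = 0 := Finsupp.single_zero m

theorem smul_term (m : FreeMonoid (Fin n)) (c d : F) :
    c • term δ m d = term δ m (c * d) := Finsupp.smul_single c m d

theorem SkewPoly.induction {p : SkewPoly σ δ → Prop} (f : SkewPoly σ δ) (h0 : p 0)
    (hadd : ∀ f g, p f → p g → p (f + g)) (ht : ∀ m c, p (term δ m c)) : p f :=
  Finsupp.induction_linear f h0 hadd ht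

/-- Additive operators `Y₁, …, Yₙ` on a left vector space obeying the rule
`Yᵢ c = ∑ⱼ σᵢⱼ(c) Yⱼ + δᵢ(c)`. -/
def Obeys (δ : SkewDerivation σ) {W : Type u} [AddCommGroup W] [Module F W]
    (Y : Fin n → AddMonoid.End W) : Prop :=
  ∀ (i : Fin n) (c : F) (w : W), Y i (c • w) = ∑ j, σ c i j • Y j w + δ c i • w

/-- For additive operators `Y₁, …, Yₙ` on a left vector space, the left linear map
`∑ F_𝔪 𝔪 ↦ ∑ F_𝔪 𝔪(Y₁, …, Yₙ)` into operators. -/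
def act (δ : SkewDerivation σ) {W : Type u} [AddCommGroup W] [Module F W]
    (Y : Fin n → AddMonoid.End W) : SkewPoly σ δ →ₗ[F] AddMonoid.End W :=
  Finsupp.linearCombination F (fun m => FreeMonoid.lift Y m)

theorem act_term {W : Type u} [AddCommGroup W] [Module F W] (Y : Fin n → AddMonoid.End W)
    (m : FreeMonoid (Fin n)) (c : F) (w : W) :
    act δ Y (term δ m c) w = c • FreeMonoid.lift Y m w := by
  have : act δ Y (term δ m c) = c • (FreeMonoid.lift Y m : AddMonoid.End W) :=
    Finsupp.linearCombination_single F c m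
  rw [this]; rfl

theorem End_add_apply {W : Type u} [AddCommGroup W] (S T : AddMonoid.End W) (w : W) :
    (S + T) w = S w + T w := rfl

theorem End_mul_apply {W : Type u} [AddCommGroup W] (S T : AddMonoid.End W) (w : W) :
    (S * T) w = S (T w) := rfl

theorem End_sub_apply {W : Type u} [AddCommGroup W] (S T : AddMonoid.End W) (w : W) :
    (S - T) w = S w - T w := rfl

theorem End_sum_apply {W : Type u} [AddCommGroup W] (s : Finset (Fin n))
    (T : Fin n → AddMonoid.End W) (w : W) : (∑ i ∈ s, T i) w = ∑ i ∈ s, T i w :=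
  AddMonoidHom.finsetSum_apply T s w

/-- Left multiplication by the variable `xᵢ`, as dictated by `xᵢ c = ∑ⱼ σᵢⱼ(c) xⱼ + δᵢ(c)`:
it maps `c 𝔪` to `∑ⱼ σᵢⱼ(c) xⱼ𝔪 + δᵢ(c) 𝔪`. -/
def mulVar (δ : SkewDerivation σ) (i : Fin n) : AddMonoid.End (SkewPoly σ δ) :=
  Finsupp.liftAddHom (M := F) (N := SkewPoly σ δ) fun m : FreeMonoid (Fin n) =>
    { toFun := fun c => ∑ j, term δ (FreeMonoid.of j * m) (σ c i j) + term δ m (δ c i)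
      map_zero' := by simp [term_zero, SkewDerivation.map_zero]
      map_add' := fun c d => by
        simp only [map_add, Matrix.add_apply, term_add, Finset.sum_add_distrib,
          Pi.add_apply]
        abel }

theorem mulVar_term (i : Fin n) (m : FreeMonoid (Fin n)) (c : F) :
    mulVar δ i (term δ m c) =
      ∑ j, term δ (FreeMonoid.of j * m) (σ c i j) + term δ m (δ c i) :=
  Finsupp.liftAddHom_apply_single _ m c

theorem mulVar_one (i : Fin n) (m : FreeMonoid (Fin n)) :
    mulVar δ i (term δ m 1) = term δ (FreeMonoid.of i * m) 1 := by
  rw [mulVar_term, SkewDerivation.map_one, Pi.zero_apply, term_zero, add_zero, map_one,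
    Finset.sum_eq_single i]
  · simp
  · intro j _ hj
    rw [Matrix.one_apply_ne' hj, term_zero]
  · simp

theorem obeys_mulVar : Obeys δ (mulVar δ) := by
  intro i c f
  induction f using SkewPoly.induction with
  | h0 => simp
  | hadd f g hf hg =>
    simp only [smul_add, map_add, hf, hg, Finset.sum_add_distrib]
    abel
  | ht m d =>
    simp only [smul_term, mulVar_term, smul_add, Finset.smul_sum, Finset.sum_add_distrib]
    rw [Finset.sum_comm, SkewDerivation.map_mul, term_add, ← add_assoc]
    congr 1
    congr 1
    · refine Finset.sum_congr rfl fun j _ => ?_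
      rw [map_mul_apply]
      exact map_sum (Finsupp.singleAddHom (FreeMonoid.of j * m)) _ _
    · exact map_sum (Finsupp.singleAddHom m) _ _

theorem act_mulVar {W : Type u} [AddCommGroup W] [Module F W] {Y : Fin n → AddMonoid.End W}
    (hY : Obeys δ Y) (i : Fin n) (f : SkewPoly σ δ) (w : W) :
    act δ Y (mulVar δ i f) w = Y i (act δ Y f w) := by
  induction f using SkewPoly.induction with
  | h0 => simp
  | hadd f g hf hg =>
    rw [map_add, map_add, map_add, End_add_apply, End_add_apply, map_add, hf, hg]
  | ht m c =>
    rw [mulVar_term, map_add, map_sum, act_term, hY, End_add_apply, End_sum_apply, act_term]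
    congr 1
    refine Finset.sum_congr rfl fun j _ => ?_
    rw [act_term, map_mul, FreeMonoid.lift_eval_of]
    rfl

theorem act_word {W : Type u} [AddCommGroup W] [Module F W] {Y : Fin n → AddMonoid.End W}
    (hY : Obeys δ Y) (m : FreeMonoid (Fin n)) (f : SkewPoly σ δ) (w : W) :
    act δ Y (FreeMonoid.lift (mulVar δ) m f) w = FreeMonoid.lift Y m (act δ Y f w) := by
  induction m using FreeMonoid.inductionOn' with
  | one => simp
  | of_mul i m ih =>
    rw [map_mul, map_mul, FreeMonoid.lift_eval_of, FreeMonoid.lift_eval_of,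
      End_mul_apply, End_mul_apply, act_mulVar hY, ih]

theorem act_act {W : Type u} [AddCommGroup W] [Module F W] {Y : Fin n → AddMonoid.End W}
    (hY : Obeys δ Y) (f g : SkewPoly σ δ) (w : W) :
    act δ Y (act δ (mulVar δ) f g) w = act δ Y f (act δ Y g w) := by
  induction f using SkewPoly.induction with
  | h0 => simp
  | hadd f₁ f₂ h₁ h₂ =>
    rw [map_add, map_add, End_add_apply, End_add_apply, map_add, End_add_apply, h₁, h₂]
  | ht m c =>
    rw [act_term, act_term, map_smul, ← act_word hY]
    rfl

theorem word_one (m k : FreeMonoid (Fin n)) :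
    FreeMonoid.lift (mulVar δ) m (term δ k 1) = term δ (m * k) 1 := by
  induction m using FreeMonoid.inductionOn' with
  | one => simp
  | of_mul i m ih =>
    rw [map_mul, FreeMonoid.lift_eval_of, End_mul_apply, ih, mulVar_one, mul_assoc]

theorem act_one_right (f : SkewPoly σ δ) : act δ (mulVar δ) f (term δ 1 1) = f := by
  induction f using SkewPoly.induction with
  | h0 => simp
  | hadd f g hf hg =>
    rw [map_add, End_add_apply, hf, hg]
  | ht m c => rw [act_term, word_one, mul_one, smul_term, mul_one]

theorem act_one_left {W : Type u} [AddCommGroup W] [Module F W] (Y : Fin n → AddMonoid.End W)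
    (w : W) : act δ Y (term δ 1 1) w = w := by
  rw [act_term, one_smul, map_one]; rfl

/-- The product of skew polynomials: `(∑ F_𝔪 𝔪) G = ∑ F_𝔪 (𝔪 G)`, where a monomial multiplies
letter by letter through `mulVar`. -/
instance : Mul (SkewPoly σ δ) := ⟨fun f g => act δ (mulVar δ) f g⟩

instance : One (SkewPoly σ δ) := ⟨term δ 1 1⟩

theorem mul_def (f g : SkewPoly σ δ) : f * g = act δ (mulVar δ) f g := rfl

theorem one_def : (1 : SkewPoly σ δ) = term δ 1 1 := rfl

instance : Ring (SkewPoly σ δ) :=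
  { (inferInstance : AddCommGroup (SkewPoly σ δ)) with
    mul := (· * ·)
    one := 1
    left_distrib := fun f g h => map_add (act δ (mulVar δ) f) g h
    right_distrib := fun f g h => by
      show act δ (mulVar δ) (f + g) h = _
      rw [map_add]; rfl
    zero_mul := fun f => by
      show act δ (mulVar δ) 0 f = 0
      rw [map_zero]; rfl
    mul_zero := fun f => map_zero (act δ (mulVar δ) f)
    mul_assoc := fun f g h => act_act obeys_mulVar f g h
    one_mul := fun f => act_one_left (mulVar δ) f
    mul_one := fun f => act_one_right f }

/-- `F[x; σ, δ]` is a left `F`-algebra: its product is left linear in the first factor. -/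
instance : IsScalarTower F (SkewPoly σ δ) (SkewPoly σ δ) where
  smul_assoc c f g := by
    show act δ (mulVar δ) (c • f) g = c • act δ (mulVar δ) f g
    rw [map_smul]; rfl

/-- The constant `c`, as a skew polynomial. -/
def C (δ : SkewDerivation σ) (c : F) : SkewPoly σ δ := term δ 1 c

/-- The variable `xᵢ`. -/
def X (δ : SkewDerivation σ) (i : Fin n) : SkewPoly σ δ := term δ (FreeMonoid.of i) 1

/-- The product appends monomials. -/
theorem term_mul_term_one (m k : FreeMonoid (Fin n)) (c : F) :
    term δ m c * term δ k 1 = term δ (m * k) c := by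
  rw [mul_def, act_term, word_one, smul_term, mul_one]

/-- The defining rule `xᵢ c = ∑ⱼ σᵢⱼ(c) xⱼ + δᵢ(c)`. -/
theorem X_mul_C (i : Fin n) (c : F) :
    X δ i * C δ c = ∑ j, C δ (σ c i j) * X δ j + C δ (δ c i) := by
  have h : X δ i * C δ c = mulVar δ i (C δ c) := by
    rw [mul_def, X, act_term, one_smul, FreeMonoid.lift_eval_of]
  rw [h, C, mulVar_term]
  simp only [C, X, term_mul_term_one, one_mul, mul_one]

end Ring

section Points

variable {F : Type u} [DivisionRing F] {n : ℕ} {σ : F →+* Matrix (Fin n) (Fin n) F}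
  {δ : SkewDerivation σ}

/-- The operator `𝒟_𝐚 : F → Fⁿ`, `𝒟_𝐚(β) = σ(β) 𝐚 + δ(β)`. -/
def opD (δ : SkewDerivation σ) (a : Fin n → F) (β : F) : Fin n → F :=
  Matrix.mulVec (σ β) a + δ β

theorem opD_apply (a : Fin n → F) (β : F) (i : Fin n) :
    opD δ a β i = ∑ j, σ β i j * a j + δ β i := rfl

theorem opD_add (a : Fin n → F) (β γ : F) : opD δ a (β + γ) = opD δ a β + opD δ a γ := by
  simp only [opD, map_add, Matrix.add_mulVec]
  abel

theorem opD_zero (a : Fin n → F) : opD δ a 0 = 0 := by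
  simp [opD, SkewDerivation.map_zero]

theorem opD_one (a : Fin n → F) : opD δ a 1 = a := by
  simp [opD, SkewDerivation.map_one]

theorem opD_mul (a : Fin n → F) (β γ : F) (i : Fin n) :
    opD δ a (β * γ) i = ∑ j, σ β i j * opD δ a γ j + δ β i * γ := by
  simp only [opD_apply, SkewDerivation.map_mul, map_mul_apply, mul_add, Finset.sum_add_distrib,
    Finset.sum_mul, Finset.mul_sum, mul_assoc]
  rw [Finset.sum_comm]
  abel

/-- The component `𝒟_𝐚^{xᵢ} : F → F` of `𝒟_𝐚`. -/
def opVar (δ : SkewDerivation σ) (a : Fin n → F) (i : Fin n) : AddMonoid.End F where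
  toFun β := opD δ a β i
  map_zero' := by rw [opD_zero]; rfl
  map_add' β γ := by rw [opD_add]; rfl

theorem obeys_opVar (a : Fin n → F) : Obeys δ (opVar δ a) :=
  fun i c w => opD_mul a c w i

/-- The operator `𝒟_𝐚^𝔪 : F → F` of a monomial `𝔪`: it is the identity for `𝔪 = 1`, and
`𝒟_𝐚^{xᵢ𝔪} = 𝒟_𝐚^{xᵢ} ∘ 𝒟_𝐚^𝔪`. -/
def opWord (δ : SkewDerivation σ) (a : Fin n → F) (m : FreeMonoid (Fin n)) : AddMonoid.End F :=
  FreeMonoid.lift (opVar δ a) m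

/-- The map `∑ F_𝔪 𝔪 ↦ ∑ F_𝔪 𝒟_𝐚^𝔪` from skew polynomials to operators on `F`. -/
def toOp (δ : SkewDerivation σ) (a : Fin n → F) : SkewPoly σ δ →+* AddMonoid.End F where
  toFun f := Finsupp.linearCombination F (opWord δ a) f
  map_zero' := map_zero (act δ (opVar δ a))
  map_add' := map_add (act δ (opVar δ a))
  map_one' := AddMonoidHom.ext fun w => act_one_left (opVar δ a) w
  map_mul' f g := AddMonoidHom.ext fun w => act_act (obeys_opVar a) f g w

/-- The left vector space `F[𝒟_𝐚]` of linearized polynomials, that is, the left span of the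
operators `𝒟_𝐚^𝔪`. It is closed under composition, which is its product. -/
def LinPoly (δ : SkewDerivation σ) (a : Fin n → F) : Subring (AddMonoid.End F) :=
  (toOp δ a).range.copy
    (Submodule.span F (Set.range (opWord δ a)) : Submodule F (AddMonoid.End F))
    (by
      rw [← Finsupp.range_linearCombination]
      rfl)

theorem mem_LinPoly {a : Fin n → F} {T : AddMonoid.End F} :
    T ∈ LinPoly δ a ↔ T ∈ Submodule.span F (Set.range (opWord δ a)) := Iff.rfl

theorem toOp_mem (a : Fin n → F) (f : SkewPoly σ δ) : toOp δ a f ∈ LinPoly δ a := by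
  rw [mem_LinPoly, ← Finsupp.range_linearCombination]
  exact ⟨f, rfl⟩

/-- The surjection `φ_𝐚 : F[x; σ, δ] → F[𝒟_𝐚]`, `F ↦ F^{𝒟_𝐚}`, where
`(∑ F_𝔪 𝔪)^{𝒟_𝐚} = ∑ F_𝔪 𝒟_𝐚^𝔪`. -/
def phi (δ : SkewDerivation σ) (a : Fin n → F) : SkewPoly σ δ →+* LinPoly δ a :=
  (toOp δ a).codRestrict (LinPoly δ a) (toOp_mem a)

/-- The left `F`-vector space structure of `F[𝒟_𝐚]`: `(c T)(β) = c T(β)`. -/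
instance (a : Fin n → F) : Module F (LinPoly δ a) :=
  inferInstanceAs
    (Module F (Submodule.span F (Set.range (opWord δ a)) : Submodule F (AddMonoid.End F)))

theorem smul_LinPoly_apply {a : Fin n → F} (c : F) (T : LinPoly δ a) (β : F) :
    ((c • T : LinPoly δ a) : AddMonoid.End F) β = c * (T : AddMonoid.End F) β := rfl

instance (a : Fin n → F) : IsScalarTower F (LinPoly δ a) (LinPoly δ a) where
  smul_assoc _ _ _ := rfl

/-- The remainder ideal `(x₁ - a₁, …, xₙ - aₙ)`, a left ideal. -/
def pointIdeal (δ : SkewDerivation σ) (a : Fin n → F) : Ideal (SkewPoly σ δ) :=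
  Ideal.span (Set.range fun i => X δ i - C δ (a i))

theorem toOp_C (a : Fin n → F) (c β : F) : toOp δ a (C δ c) β = c * β := by
  have h : toOp δ a (C δ c) β = c • FreeMonoid.lift (opVar δ a) 1 β :=
    act_term (opVar δ a) 1 c β
  rw [h, map_one]; rfl

theorem toOp_X (a : Fin n → F) (i : Fin n) (β : F) : toOp δ a (X δ i) β = opD δ a β i := by
  have h : toOp δ a (X δ i) β = (1 : F) • FreeMonoid.lift (opVar δ a) (FreeMonoid.of i) β :=
    act_term (opVar δ a) _ 1 β
  rw [h, one_smul, FreeMonoid.lift_eval_of]; rfl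

theorem toOp_eq_zero_of_mem (a : Fin n → F) {f : SkewPoly σ δ} (hf : f ∈ pointIdeal δ a) :
    toOp δ a f 1 = 0 := by
  induction hf using Submodule.span_induction with
  | mem f h =>
    obtain ⟨i, rfl⟩ := h
    rw [map_sub, End_sub_apply, toOp_X, toOp_C, opD_one, mul_one, sub_self]
  | zero => rw [map_zero]; rfl
  | add f g _ _ hf hg =>
    rw [map_add, End_add_apply, hf, hg, add_zero]
  | smul g f _ hf => rw [smul_eq_mul, map_mul, End_mul_apply, hf, map_zero]

theorem C_add (c d : F) : C δ (c + d) = C δ c + C δ d := term_add 1 c d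

theorem C_zero : C δ 0 = 0 := term_zero 1

theorem C_mul_eq_smul (c : F) (f : SkewPoly σ δ) : C δ c * f = c • f := by
  rw [mul_def, C, act_term, map_one]; rfl

theorem smul_C (c d : F) : c • C δ d = C δ (c * d) := smul_term 1 c d

theorem X_mul_C_sub_mem (a : Fin n → F) (i : Fin n) (c : F) :
    X δ i * C δ c - C δ (opD δ a c i) ∈ pointIdeal δ a := by
  have hC : ∀ (s : Finset (Fin n)) (v : Fin n → F),
      C δ (∑ j ∈ s, v j) = ∑ j ∈ s, C δ (v j) := fun s v =>
    map_sum (Finsupp.singleAddHom (1 : FreeMonoid (Fin n))) v s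
  have h : X δ i * C δ c - C δ (opD δ a c i) =
      ∑ j, C δ (σ c i j) * (X δ j - C δ (a j)) := by
    rw [X_mul_C, opD_apply, C_add, hC, add_sub_add_right_eq_sub, ← Finset.sum_sub_distrib]
    refine Finset.sum_congr rfl fun j _ => ?_
    rw [mul_sub, C_mul_eq_smul _ (C δ (a j)), smul_C]
  rw [h]
  exact Submodule.sum_mem _ fun j _ =>
    Ideal.mul_mem_left _ _ (Submodule.subset_span ⟨j, rfl⟩)

theorem sub_C_mem (a : Fin n → F) (f : SkewPoly σ δ) :
    f - C δ (toOp δ a f 1) ∈ pointIdeal δ a := by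
  induction f using SkewPoly.induction with
  | h0 =>
    have h : toOp δ a (0 : SkewPoly σ δ) 1 = 0 := by rw [map_zero]; rfl
    rw [h, C_zero, sub_zero]
    exact Submodule.zero_mem _
  | hadd f g hf hg =>
    have h : toOp δ a (f + g) 1 = toOp δ a f 1 + toOp δ a g 1 := by rw [map_add]; rfl
    rw [h, C_add, add_sub_add_comm]
    exact Submodule.add_mem _ hf hg
  | ht m c =>
    have key : ∀ m : FreeMonoid (Fin n),
        term δ m 1 - C δ (toOp δ a (term δ m 1) 1) ∈ pointIdeal δ a := by
      intro m
      induction m using FreeMonoid.inductionOn' with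
      | one =>
        have h : toOp δ a (term δ 1 1) 1 = 1 := act_one_left (opVar δ a) 1
        rw [h, C, sub_self]
        exact Submodule.zero_mem _
      | of_mul i m ih =>
        have hm : term δ (FreeMonoid.of i * m) 1 = X δ i * term δ m 1 := by
          rw [X, term_mul_term_one]
        rw [hm, map_mul, End_mul_apply, toOp_X]
        have h1 := Ideal.mul_mem_left _ (X δ i) ih
        rw [mul_sub] at h1
        have h2 := Submodule.add_mem _ h1
          (X_mul_C_sub_mem a i (toOp δ a (term δ m 1) 1))
        rwa [sub_add_sub_cancel] at h2
    have hm : term δ m c = C δ c * term δ m 1 := by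
      rw [C, term_mul_term_one, one_mul]
    have h1 := Ideal.mul_mem_left _ (C δ c) (key m)
    rw [mul_sub] at h1
    rw [hm, map_mul, End_mul_apply, toOp_C]
    convert h1 using 2
    rw [C_mul_eq_smul, smul_C]

/-- Remainders exist and are unique. -/
theorem existsUnique_eval (a : Fin n → F) (f : SkewPoly σ δ) :
    ∃! c : F, f - C δ c ∈ pointIdeal δ a := by
  refine ⟨toOp δ a f 1, sub_C_mem a f, fun c hc => ?_⟩
  have h := toOp_eq_zero_of_mem a hc
  have h2 : toOp δ a (f - C δ c) 1 = toOp δ a f 1 - toOp δ a (C δ c) 1 := by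
    rw [map_sub]; rfl
  rw [h2, toOp_C, mul_one, sub_eq_zero] at h
  exact h.symm

/-- The skew evaluation `F(𝐚)`: the unique `c ∈ F` with `F - c ∈ (x₁ - a₁, …, xₙ - aₙ)`. -/
def eval (a : Fin n → F) (f : SkewPoly σ δ) : F := (existsUnique_eval a f).choose

theorem eval_spec (a : Fin n → F) (f : SkewPoly σ δ) : f - C δ (eval a f) ∈ pointIdeal δ a :=
  (existsUnique_eval a f).choose_spec.1

theorem eval_eq_zero_iff {a : Fin n → F} {f : SkewPoly σ δ} :
    eval a f = 0 ↔ f ∈ pointIdeal δ a := by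
  constructor
  · intro h
    have h1 := eval_spec a f
    rwa [h, C_zero, sub_zero] at h1
  · intro h
    refine (existsUnique_eval a f).unique (eval_spec a f) ?_
    rwa [C_zero, sub_zero]

/-- The left ideal `I(Ω)` of the skew polynomials that vanish on `Ω`. -/
def vanishingIdeal (δ : SkewDerivation σ) (Ω : Set (Fin n → F)) : Ideal (SkewPoly σ δ) where
  carrier := {f | ∀ a ∈ Ω, eval a f = 0}
  zero_mem' _ _ := eval_eq_zero_iff.2 (Submodule.zero_mem _)
  add_mem' hf hg a ha := eval_eq_zero_iff.2
    (Submodule.add_mem _ (eval_eq_zero_iff.1 (hf a ha)) (eval_eq_zero_iff.1 (hg a ha)))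
  smul_mem' c _ hf a ha := eval_eq_zero_iff.2
    (Submodule.smul_mem _ c (eval_eq_zero_iff.1 (hf a ha)))

/-- The zero set `Z(𝒜)`. -/
def zeroSet (A : Set (SkewPoly σ δ)) : Set (Fin n → F) := {a | ∀ f ∈ A, eval a f = 0}

/-- The P-closure `Z(I(Ω))`. -/
def pClosure (δ : SkewDerivation σ) (Ω : Set (Fin n → F)) : Set (Fin n → F) :=
  zeroSet (vanishingIdeal δ Ω : Set (SkewPoly σ δ))

/-- P-closed sets. -/
def IsPClosed (δ : SkewDerivation σ) (Ω : Set (Fin n → F)) : Prop := pClosure δ Ω = Ω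

/-- `Ω` has a finite set of P-generators. -/
def IsPFinGen (δ : SkewDerivation σ) (Ω : Set (Fin n → F)) : Prop :=
  ∃ G ⊆ Ω, G.Finite ∧ pClosure δ G = Ω

/-- P-independent sets. -/
def IsPIndep (δ : SkewDerivation σ) (B : Set (Fin n → F)) : Prop :=
  ∀ a ∈ B, a ∉ pClosure δ (B \ {a})

/-- `B` is a P-basis of `Ω`: a P-independent set of P-generators. -/
def IsPBasis (δ : SkewDerivation σ) (B Ω : Set (Fin n → F)) : Prop :=
  B ⊆ Ω ∧ IsPIndep δ B ∧ pClosure δ B = Ω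

/-- The rank `Rk(Ω)` of a finitely generated P-closed set: the number of elements of a
P-basis. (All its P-bases are finite of the same size, so that the infimum is that size.) -/
def pRank (δ : SkewDerivation σ) (Ω : Set (Fin n → F)) : ℕ :=
  sInf {k | ∃ B, IsPBasis δ B Ω ∧ B.Finite ∧ B.ncard = k}

/-- The conjugate `𝐚^β = 𝒟_𝐚(β) β⁻¹` (used for `β ≠ 0`). -/
def conj (δ : SkewDerivation σ) (a : Fin n → F) (β : F) : Fin n → F :=
  fun i => opD δ a β i * β⁻¹

/-- The conjugacy class `𝒞(𝐚)`. -/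
def conjClass (δ : SkewDerivation σ) (a : Fin n → F) : Set (Fin n → F) :=
  {b | ∃ β : F, β ≠ 0 ∧ b = conj δ a β}

theorem opD_mul_of_mem {a : Fin n → F} (β : F) {γ : F} (hγ : opD δ a γ = fun i => a i * γ) :
    opD δ a (β * γ) = fun i => opD δ a β i * γ := by
  funext i
  rw [opD_mul, hγ, opD_apply, add_mul, Finset.sum_mul]
  simp only [mul_assoc]

/-- The centralizer `K_𝐚 = {β | 𝒟_𝐚(β) = 𝐚 β}`, a division subring of `F`. -/
def centralizer (δ : SkewDerivation σ) (a : Fin n → F) : Subfield F where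
  carrier := {β | opD δ a β = fun i => a i * β}
  mul_mem' {β γ} hβ hγ := by
    simp only [Set.mem_ofPred_eq] at hβ hγ ⊢
    rw [opD_mul_of_mem β hγ, hβ]
    simp only [mul_assoc]
  one_mem' := by simp [opD_one]
  add_mem' {β γ} hβ hγ := by
    simp only [Set.mem_ofPred_eq] at hβ hγ ⊢
    rw [opD_add, hβ, hγ]
    funext i
    simp [mul_add]
  zero_mem' := by
    simp only [Set.mem_ofPred_eq, opD_zero, mul_zero]
    rfl
  neg_mem' {β} hβ := by
    simp only [Set.mem_ofPred_eq] at hβ ⊢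
    have h := opD_add (δ := δ) a β (-β)
    rw [add_neg_cancel, opD_zero, hβ] at h
    rw [eq_neg_of_add_eq_zero_right h.symm]
    funext i
    simp
  inv_mem' β hβ := by
    rcases eq_or_ne β 0 with rfl | h0
    · rwa [inv_zero]
    · have hβ' : opD δ a β = fun i => a i * β := hβ
      have h := opD_mul_of_mem (δ := δ) β⁻¹ hβ'
      rw [inv_mul_cancel₀ h0, opD_one] at h
      show opD δ a β⁻¹ = fun i => a i * β⁻¹
      funext i
      have hi := congrFun h i
      rw [hi, mul_assoc, mul_inv_cancel₀ h0, mul_one]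

/-- `F` as a right vector space over `K_𝐚`, that is, a left one over the opposite ring. -/
instance (a : Fin n → F) : Module (↥(centralizer δ a))ᵐᵒᵖ F :=
  Module.compHom F (RingHom.op (centralizer δ a).subtype)

theorem op_smul_eq {a : Fin n → F} (k : centralizer δ a) (β : F) :
    MulOpposite.op k • β = β * (k : F) := rfl

/-- The right `K_𝐚`-subspace `Ω^𝒟` of `F` that corresponds to `Ω ⊆ 𝒞(𝐚)`: the one generated by
the `β ≠ 0` with `𝐚^β ∈ Ω`. -/
def linSpace (δ : SkewDerivation σ) (a : Fin n → F) (Ω : Set (Fin n → F)) :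
    Submodule (↥(centralizer δ a))ᵐᵒᵖ F :=
  Submodule.span _ {β : F | β ≠ 0 ∧ conj δ a β ∈ Ω}

/-- The left ideal `I(V)` of `F[𝒟_𝐚]` of the linearized polynomials that vanish on a right
`K_𝐚`-subspace `V` of `F`. -/
def linIdeal (δ : SkewDerivation σ) (a : Fin n → F)
    (V : Submodule (↥(centralizer δ a))ᵐᵒᵖ F) : Ideal (LinPoly δ a) where
  carrier := {T | ∀ β ∈ V, (T : AddMonoid.End F) β = 0}
  zero_mem' _ _ := rfl
  add_mem' {S T} hS hT β hβ := by
    show (S : AddMonoid.End F) β + (T : AddMonoid.End F) β = 0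
    rw [hS β hβ, hT β hβ, add_zero]
  smul_mem' S T hT β hβ := by
    show (S : AddMonoid.End F) ((T : AddMonoid.End F) β) = 0
    rw [hT β hβ, map_zero]

end Points

end

end SkewPolys

open SkewPolys

/-! The link between points and operators is the product rule `toOp_eq_eval_conj_mul`: `F^{𝒟_𝐚}(β) =
F(𝐚^β) β` for `β ≠ 0`. Inside `𝒞(𝐚)`, vanishing at points is thus vanishing of right `K_𝐚`-linear
operators on `F`, so `φ_𝐚` identifies `R/I(Ω_i)` with `F[𝒟_𝐚]/I(Ω_i^𝒟)`.

P-independence behaves like linear independence, because a P-independent set has dual skew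
polynomials `e_c`, with value `1` at `c` and `0` at the other points. This gives Lagrange
interpolation, the exchange bound `IsPIndep.card_le`, finite P-bases of constant size, and `dim
R/I(B) = |B|`.

The decisive lemma is `IsPIndep.exists_sum_eq_one`: if `𝐛` lies in the P-closure of a finite
P-independent `B`, the scalars `k_c = e_c(𝐛)` sum to `1`, and each nonzero `k_c` conjugates `𝐛` to
`c`. Hence P-closure relations never mix conjugacy classes: the pieces `Ω_i` are P-closed, and
unions of P-independent sets from distinct classes stay P-independent, which by interpolation yields
the Chinese remainder isomorphism. Multiplied by `γ`, the same decomposition shows that a P-basis of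
`Ω_i` gives a `K_𝐚`-basis of `Ω_i^𝒟`.

Two-sidedness of `I(Ω)` forces each `Ω_i` to be all of `𝒞(𝐚_i)`, whose ideal is the kernel of the
ring morphism `toOp`. -/

namespace SkewPolys

/-! ### Evaluation, the product rule and conjugation. -/

section Evaluation

variable {F : Type u} [DivisionRing F] {n : ℕ} {σ : F →+* Matrix (Fin n) (Fin n) F}
  {δ : SkewDerivation σ}

/-- Evaluation at `𝐚` is the value at `1` of the operator `F^{𝒟_𝐚}`. -/
theorem eval_eq_toOp (a : Fin n → F) (f : SkewPoly σ δ) : eval a f = toOp δ a f 1 :=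
  (existsUnique_eval a f).unique (eval_spec a f) (sub_C_mem a f)

theorem toOp_smul (a : Fin n → F) (c : F) (f : SkewPoly σ δ) (β : F) :
    toOp δ a (c • f) β = c * toOp δ a f β := by
  rw [← C_mul_eq_smul, map_mul, End_mul_apply, toOp_C]

/-- Evaluation at `𝐚`, as a left linear map. -/
noncomputable def evalLin (δ : SkewDerivation σ) (a : Fin n → F) : SkewPoly σ δ →ₗ[F] F where
  toFun f := eval a f
  map_add' f g := by simp only [eval_eq_toOp, map_add, End_add_apply]
  map_smul' c f := by simp only [eval_eq_toOp, toOp_smul, RingHom.id_apply, smul_eq_mul]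

theorem eval_sub (a : Fin n → F) (f g : SkewPoly σ δ) : eval a (f - g) = eval a f - eval a g :=
  map_sub (evalLin δ a) f g

theorem eval_smul (a : Fin n → F) (c : F) (f : SkewPoly σ δ) :
    eval a (c • f) = c * eval a f := map_smul (evalLin δ a) c f

theorem eval_sum {ι : Type*} (a : Fin n → F) (s : Finset ι) (f : ι → SkewPoly σ δ) :
    eval a (∑ i ∈ s, f i) = ∑ i ∈ s, eval a (f i) := map_sum (evalLin δ a) f s

theorem eval_one (a : Fin n → F) : eval a (1 : SkewPoly σ δ) = 1 := by
  rw [eval_eq_toOp, map_one (toOp δ a)]; rfl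

theorem eval_X_mul (a : Fin n → F) (i : Fin n) (f : SkewPoly σ δ) :
    eval a (X δ i * f) = opD δ a (eval a f) i := by
  rw [eval_eq_toOp, map_mul, End_mul_apply, toOp_X, ← eval_eq_toOp]

/-- A scalar `β` with `𝒟_𝐚(β) = 𝐛 β` intertwines the operators of `𝐛` and `𝐚`. -/
theorem opD_mul_of_eq {a b : Fin n → F} {β : F} (h : opD δ a β = fun i => b i * β) (γ : F) :
    opD δ a (γ * β) = fun i => opD δ b γ i * β := by
  funext i
  rw [opD_mul, h, opD_apply, add_mul, Finset.sum_mul]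
  simp only [mul_assoc]

/-- Right multiplication by `β` intertwines the operators of the variables and commutes with left
multiplication by coefficients, hence intertwines all operators. -/
theorem toOp_mul_of_eq {a b : Fin n → F} {β : F} (h : opD δ a β = fun i => b i * β)
    (f : SkewPoly σ δ) (γ : F) : toOp δ a f (γ * β) = toOp δ b f γ * β := by
  induction f using SkewPoly.induction with
  | h0 =>
    rw [map_zero, map_zero]
    exact (zero_mul β).symm
  | hadd f g hf hg => rw [map_add, map_add, End_add_apply, End_add_apply, hf, hg, add_mul]
  | ht m c =>
    have hm : term δ m c = c • term δ m 1 := by rw [smul_term, mul_one]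
    rw [hm, toOp_smul, toOp_smul, mul_assoc]
    congr 1
    clear hm
    induction m using FreeMonoid.inductionOn' with
    | one =>
      rw [← one_def, map_one (toOp δ a), map_one (toOp δ b)]; rfl
    | of_mul i m ih =>
      have hX : term δ (FreeMonoid.of i * m) 1 = X δ i * term δ m 1 := by
        rw [X, term_mul_term_one]
      rw [hX, map_mul (toOp δ a), map_mul (toOp δ b), End_mul_apply, End_mul_apply, toOp_X, toOp_X,
        ih, opD_mul_of_eq h]

/-- The product rule for evaluations. -/
theorem toOp_eq_eval_mul {a b : Fin n → F} {β : F} (h : opD δ a β = fun i => b i * β)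
    (f : SkewPoly σ δ) : toOp δ a f β = eval b f * β := by
  rw [eval_eq_toOp, ← toOp_mul_of_eq h, one_mul]

theorem opD_eq_conj_mul (a : Fin n → F) {β : F} (hβ : β ≠ 0) :
    opD δ a β = fun i => conj δ a β i * β := by
  funext i
  rw [conj, mul_assoc, inv_mul_cancel₀ hβ, mul_one]

theorem eq_conj_of_opD_eq {a b : Fin n → F} {β : F} (hβ : β ≠ 0)
    (h : opD δ a β = fun i => b i * β) : b = conj δ a β := by
  funext i
  rw [conj, h, mul_assoc, mul_inv_cancel₀ hβ, mul_one]

theorem toOp_eq_eval_conj_mul (a : Fin n → F) {β : F} (hβ : β ≠ 0) (f : SkewPoly σ δ) :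
    toOp δ a f β = eval (conj δ a β) f * β :=
  toOp_eq_eval_mul (opD_eq_conj_mul a hβ) f

theorem conj_one (a : Fin n → F) : conj δ a 1 = a :=
  (eq_conj_of_opD_eq one_ne_zero (by simp [opD_one])).symm

theorem conj_conj (a : Fin n → F) {β γ : F} (hβ : β ≠ 0) (hγ : γ ≠ 0) :
    conj δ (conj δ a β) γ = conj δ a (γ * β) := by
  refine eq_conj_of_opD_eq (mul_ne_zero hγ hβ) ?_
  rw [opD_mul_of_eq (opD_eq_conj_mul a hβ), opD_eq_conj_mul _ hγ]
  simp only [mul_assoc]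

theorem mem_conjClass_symm {a b : Fin n → F} (h : b ∈ conjClass δ a) : a ∈ conjClass δ b := by
  obtain ⟨β, hβ, rfl⟩ := h
  exact ⟨β⁻¹, inv_ne_zero hβ, by
    rw [conj_conj a hβ (inv_ne_zero hβ), inv_mul_cancel₀ hβ, conj_one]⟩

theorem mem_conjClass_trans {a b c : Fin n → F} (h : b ∈ conjClass δ a)
    (h' : c ∈ conjClass δ b) : c ∈ conjClass δ a := by
  obtain ⟨β, hβ, rfl⟩ := h
  obtain ⟨γ, hγ, rfl⟩ := h'
  exact ⟨γ * β, mul_ne_zero hγ hβ, conj_conj a hβ hγ⟩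

/-- The case `𝐛 = 𝐚` of the intertwining. It makes the zeros of an operator a right `K_𝐚`-subspace.
-/
theorem toOp_op_smul (a : Fin n → F) (f : SkewPoly σ δ) (k : (↥(centralizer δ a))ᵐᵒᵖ) (β : F) :
    toOp δ a f (k • β) = k • toOp δ a f β :=
  toOp_mul_of_eq k.unop.2 f β

/-- Scalars with the same conjugate of `𝐚` differ by a right factor in the centralizer. -/
theorem exists_op_smul_eq {a b : Fin n → F} {β γ : F} (hβ : β ≠ 0)
    (hb : opD δ a β = fun i => b i * β) (hc : opD δ a γ = fun i => b i * γ) :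
    ∃ k : (↥(centralizer δ a))ᵐᵒᵖ, γ = k • β := by
  -- `β⁻¹` leads from `𝐛` back to `𝐚`, so the composite scalar `β⁻¹ γ` fixes `𝐚`.
  have hab : opD δ b β⁻¹ = fun i => a i * β⁻¹ := by
    have h := opD_eq_conj_mul (δ := δ) b (inv_ne_zero hβ)
    rwa [eq_conj_of_opD_eq hβ hb, conj_conj a hβ (inv_ne_zero hβ), inv_mul_cancel₀ hβ,
      conj_one, ← eq_conj_of_opD_eq hβ hb] at h
  have hm : β⁻¹ * γ ∈ centralizer δ a := by
    show opD δ a (β⁻¹ * γ) = fun i => a i * (β⁻¹ * γ)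
    rw [opD_mul_of_eq hc, hab]
    simp only [mul_assoc]
  refine ⟨MulOpposite.op ⟨β⁻¹ * γ, hm⟩, ?_⟩
  rw [op_smul_eq, mul_inv_cancel_left₀ hβ]

end Evaluation

/-! ### P-independence, dual skew polynomials and rank. -/

section Closure

variable {F : Type u} [DivisionRing F] {n : ℕ} {σ : F →+* Matrix (Fin n) (Fin n) F}
  {δ : SkewDerivation σ}

theorem mem_vanishingIdeal {Ω : Set (Fin n → F)} {f : SkewPoly σ δ} :
    f ∈ vanishingIdeal δ Ω ↔ ∀ a ∈ Ω, eval a f = 0 := Iff.rfl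

theorem mem_pClosure {Ω : Set (Fin n → F)} {a : Fin n → F} :
    a ∈ pClosure δ Ω ↔ ∀ f ∈ vanishingIdeal δ Ω, eval a f = 0 := Iff.rfl

theorem vanishingIdeal_anti {S T : Set (Fin n → F)} (h : S ⊆ T) :
    vanishingIdeal δ T ≤ vanishingIdeal δ S := fun _ hf _ ha => hf _ (h ha)

theorem pClosure_mono {S T : Set (Fin n → F)} (h : S ⊆ T) : pClosure δ S ⊆ pClosure δ T :=
  fun _ ha _ hf => ha _ (vanishingIdeal_anti h hf)

theorem subset_pClosure (S : Set (Fin n → F)) : S ⊆ pClosure δ S := fun a ha _ hf => hf a ha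

theorem vanishingIdeal_pClosure (S : Set (Fin n → F)) :
    vanishingIdeal δ (pClosure δ S) = vanishingIdeal δ S :=
  le_antisymm (vanishingIdeal_anti (subset_pClosure S)) fun f hf _ ha => ha f hf

theorem pClosure_subset {S T : Set (Fin n → F)} (h : S ⊆ pClosure δ T) :
    pClosure δ S ⊆ pClosure δ T := fun _ ha f hf =>
  ha f fun _ hb => h hb f hf

theorem IsPIndep.mono {B B' : Set (Fin n → F)} (hB : IsPIndep δ B) (h : B' ⊆ B) :
    IsPIndep δ B' := fun a ha hc =>
  hB a (h ha) (pClosure_mono (Set.sdiff_subset_sdiff_left h) hc)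

theorem IsPIndep.exists_dual {B : Set (Fin n → F)} (hB : IsPIndep δ B) {c : Fin n → F}
    (hc : c ∈ B) :
    ∃ e : SkewPoly σ δ, eval c e = 1 ∧ ∀ b ∈ B, b ≠ c → eval b e = 0 := by
  have h := hB c hc
  simp only [mem_pClosure, not_forall] at h
  obtain ⟨f, hf, hne⟩ := h
  refine ⟨(eval c f)⁻¹ • f, by rw [eval_smul, inv_mul_cancel₀ hne], fun b hb hbc => ?_⟩
  rw [eval_smul, hf b ⟨hb, hbc⟩, mul_zero]

theorem isPIndep_of_exists_dual {B : Set (Fin n → F)}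
    (h : ∀ c ∈ B, ∃ e : SkewPoly σ δ, eval c e ≠ 0 ∧ ∀ b ∈ B, b ≠ c → eval b e = 0) :
    IsPIndep δ B := fun c hc hcl => by
  obtain ⟨e, he, h0⟩ := h c hc
  exact he (hcl e fun b hb => h0 b hb.1 hb.2)

/-- Lagrange interpolation on a finite P-independent set. -/
theorem IsPIndep.exists_eval_eq {B : Finset (Fin n → F)} (hB : IsPIndep δ (B : Set (Fin n → F)))
    (v : (Fin n → F) → F) : ∃ f : SkewPoly σ δ, ∀ b ∈ B, eval b f = v b := by
  classical
  choose e he h0 using fun c : B => hB.exists_dual c.2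
  refine ⟨∑ c : B, v c • e c, fun b hb => ?_⟩
  rw [eval_sum, Finset.sum_eq_single (⟨b, hb⟩ : B)]
  · rw [eval_smul, he ⟨b, hb⟩, mul_one]
  · intro c _ hc
    rw [eval_smul, h0 c b hb fun h => hc (Subtype.ext h.symm), mul_zero]
  · exact fun h => absurd (Finset.mem_univ _) h

theorem IsPIndep.insert {B : Set (Fin n → F)} (hB : IsPIndep δ B) {s : Fin n → F}
    (hs : s ∉ pClosure δ B) : IsPIndep δ (insert s B) := by
  simp only [mem_pClosure, not_forall] at hs
  obtain ⟨f, hf, hne⟩ := hs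
  refine isPIndep_of_exists_dual fun c hc => ?_
  rcases hc with rfl | hc
  · exact ⟨f, hne, fun b hb hbc => hf b (hb.resolve_left hbc)⟩
  · obtain ⟨e, he, h0⟩ := hB.exists_dual hc
    -- As `f` vanishes on `B` but not at `s`, subtracting this multiple kills the value at `s`
    -- without changing any value on `B`.
    refine ⟨e - (eval s e * (eval s f)⁻¹) • f, ?_, fun b hb hbc => ?_⟩
    · rw [eval_sub, eval_smul, hf c hc, mul_zero, sub_zero, he]
      exact one_ne_zero
    · rcases hb with rfl | hb
      · rw [eval_sub, eval_smul, mul_assoc, inv_mul_cancel₀ hne, mul_one, sub_self]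
      · rw [eval_sub, eval_smul, hf b hb, mul_zero, sub_zero, h0 b hb hbc]

/-- The value vectors on `G` of the dual skew polynomials of `B` are linearly independent in `F^G`:
a combination vanishing on `G` vanishes on its P-closure, hence at each `c ∈ B`, where its value is
the coefficient of `e_c`. -/
theorem IsPIndep.card_le {B G : Finset (Fin n → F)} (hB : IsPIndep δ (B : Set (Fin n → F)))
    (hG : (B : Set (Fin n → F)) ⊆ pClosure δ (G : Set (Fin n → F))) : B.card ≤ G.card := by
  classical
  choose e he h0 using fun c : B => hB.exists_dual c.2
  let ev : SkewPoly σ δ →ₗ[F] (G → F) := LinearMap.pi fun g => evalLin δ (g : Fin n → F)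
  have hli : LinearIndependent F fun c => ev (e c) := by
    rw [Fintype.linearIndependent_iff]
    intro v hv c
    have hI : ∑ c, v c • e c ∈ vanishingIdeal δ (G : Set (Fin n → F)) := fun g hg => by
      have h := congrFun (show ev (∑ c, v c • e c) = 0 by
        rw [map_sum, ← hv]; simp only [map_smul]) ⟨g, hg⟩
      exact h
    have h := hG c.2 _ hI
    rw [eval_sum, Finset.sum_eq_single c] at h
    · rwa [eval_smul, he, mul_one] at h
    · intro b _ hb
      rw [eval_smul, h0 b c c.2 fun h => hb (Subtype.ext h.symm), mul_zero]
    · exact fun h => absurd (Finset.mem_univ _) h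
  have := hli.fintype_card_le_finrank
  simpa using this

/-- The sizes of P-independent subsets of `S` are bounded by `|G|`. One of largest size generates,
since a point outside its P-closure could be added. -/
theorem exists_isPIndep_pClosure_eq {S : Set (Fin n → F)} {G : Finset (Fin n → F)}
    (hS : S ⊆ pClosure δ (G : Set (Fin n → F))) :
    ∃ B : Finset (Fin n → F), (B : Set (Fin n → F)) ⊆ S ∧
      IsPIndep δ (B : Set (Fin n → F)) ∧ pClosure δ (B : Set (Fin n → F)) = pClosure δ S := by
  classical
  let P : ℕ → Prop := fun k => ∃ B : Finset (Fin n → F), (B : Set (Fin n → F)) ⊆ S ∧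
    IsPIndep δ (B : Set (Fin n → F)) ∧ B.card = k
  have h0 : P 0 := ⟨∅, by simp, fun a ha => by simp at ha, rfl⟩
  have hle : ∀ k, P k → k ≤ G.card := by
    rintro k ⟨B, hBS, hB, rfl⟩
    exact hB.card_le (hBS.trans hS)
  obtain ⟨B, hBS, hB, hk⟩ : P (Nat.findGreatest P G.card) :=
    Nat.findGreatest_spec (Nat.zero_le _) h0
  refine ⟨B, hBS, hB, (pClosure_mono hBS).antisymm (pClosure_subset fun s hs => ?_)⟩
  by_contra hcl
  have hsB : s ∉ B := fun h => hcl (subset_pClosure _ h)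
  have hP : P (B.card + 1) := ⟨insert s B, by
    rw [Finset.coe_insert]; exact Set.insert_subset hs hBS, by
    rw [Finset.coe_insert]; exact hB.insert hcl, Finset.card_insert_of_notMem hsB⟩
  have := Nat.le_findGreatest (hle _ hP) hP
  omega

/-- An infinite P-basis would contain `|G| + 1` P-independent points. -/
theorem IsPBasis.finite {B Ω : Set (Fin n → F)} {G : Finset (Fin n → F)}
    (hB : IsPBasis δ B Ω) (hG : Ω ⊆ pClosure δ (G : Set (Fin n → F))) : B.Finite := by
  by_contra hinf
  obtain ⟨t, ht, hcard⟩ := Set.Infinite.exists_subset_card_eq hinf (G.card + 1)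
  have := (hB.2.1.mono ht).card_le (ht.trans (hB.1.trans hG))
  omega

theorem IsPBasis.ncard_le {B B' Ω : Set (Fin n → F)} (hB : IsPBasis δ B Ω)
    (hB' : IsPBasis δ B' Ω) (hf : B.Finite) (hf' : B'.Finite) : B.ncard ≤ B'.ncard := by
  lift B to Finset (Fin n → F) using hf
  lift B' to Finset (Fin n → F) using hf'
  rw [Set.ncard_coe_finset, Set.ncard_coe_finset]
  exact hB.2.1.card_le (hB.1.trans hB'.2.2.ge)

theorem IsPBasis.ncard_eq_pRank {B Ω : Set (Fin n → F)} (hB : IsPBasis δ B Ω)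
    (hf : B.Finite) : B.ncard = pRank δ Ω := by
  have hs : {k | ∃ B, IsPBasis δ B Ω ∧ B.Finite ∧ B.ncard = k} = {B.ncard} := by
    ext k
    constructor
    · rintro ⟨B', hB', hf', rfl⟩
      exact le_antisymm (hB'.ncard_le hB hf' hf) (hB.ncard_le hB' hf hf')
    · rintro rfl
      exact ⟨B, hB, hf, rfl⟩
  rw [pRank, hs, csInf_singleton]

/-- A point of the P-closure of a finite P-independent set `B` decomposes `1` into scalars that
conjugate it into `B`. -/
theorem IsPIndep.exists_sum_eq_one {B : Finset (Fin n → F)}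
    (hB : IsPIndep δ (B : Set (Fin n → F))) {b : Fin n → F}
    (hb : b ∈ pClosure δ (B : Set (Fin n → F))) :
    ∃ k : B → F, (∀ c, opD δ b (k c) = fun i => (c : Fin n → F) i * k c) ∧ ∑ c, k c = 1 := by
  classical
  choose e he h0 using fun c : B => hB.exists_dual c.2
  refine ⟨fun c => eval b (e c), fun c => funext fun i => ?_, ?_⟩
  -- `(xᵢ - cᵢ) e_c` vanishes on `B`: at `c` because `𝒟_c(1) = c`, elsewhere because `e_c` does. Its
  -- value at `𝐛` is the required identity.
  · have h := hb (X δ i * e c - (c : Fin n → F) i • e c) fun c' hc' => by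
      rw [eval_sub, eval_X_mul, eval_smul]
      rcases eq_or_ne c' c with rfl | hne
      · rw [he, opD_one, mul_one, sub_self]
      · rw [h0 c c' hc' hne, opD_zero, mul_zero, Pi.zero_apply, sub_zero]
    rwa [eval_sub, eval_X_mul, eval_smul, sub_eq_zero] at h
  -- `∑ e_c` takes the value `1` on all of `B`, hence also at `𝐛`.
  · have h := hb (∑ c, e c - 1) fun c' hc' => by
      rw [eval_sub, eval_one, eval_sum, Finset.sum_eq_single (⟨c', hc'⟩ : B), he ⟨c', hc'⟩,
        sub_self]
      · intro c _ hc
        exact h0 c c' hc' fun h => hc (Subtype.ext h.symm)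
      · exact fun h => absurd (Finset.mem_univ _) h
    rwa [eval_sub, eval_one, eval_sum, sub_eq_zero] at h

/-- Converse of the decomposition: `F(𝐛) = F^{𝒟_𝐛}(∑ k_c) = ∑ F(p_c) k_c`. Only points with `k_c ≠
0` matter, so only these need lie in `B`. -/
theorem mem_pClosure_of_sum_eq_one {B : Set (Fin n → F)} {b : Fin n → F} {ι : Type*}
    (s : Finset ι) (k : ι → F) (p : ι → Fin n → F) (hp : ∀ c ∈ s, k c ≠ 0 → p c ∈ B)
    (hk : ∀ c ∈ s, opD δ b (k c) = fun i => p c i * k c) (h1 : ∑ c ∈ s, k c = 1) :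
    b ∈ pClosure δ B := fun f hf => by
  rw [eval_eq_toOp, ← h1, map_sum]
  refine Finset.sum_eq_zero fun c hc => ?_
  rcases eq_or_ne (k c) 0 with h0 | h0
  · rw [h0, map_zero]
  · rw [toOp_eq_eval_mul (hk c hc), hf _ (hp c hc h0), zero_mul]

/-- Evaluation on `B` has kernel `I(B)` and, by interpolation, maps onto `F^B`. -/
theorem rank_quotient_vanishingIdeal {B : Finset (Fin n → F)}
    (hB : IsPIndep δ (B : Set (Fin n → F))) :
    Module.rank F (SkewPoly σ δ ⧸ vanishingIdeal δ (B : Set (Fin n → F))) =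
      (B.card : Cardinal.{u}) := by
  let ev : SkewPoly σ δ →ₗ[F] (B → F) := LinearMap.pi fun b => evalLin δ (b : Fin n → F)
  have hker : LinearMap.ker ev =
      (vanishingIdeal δ (B : Set (Fin n → F))).restrictScalars F := by
    ext f
    rw [LinearMap.mem_ker, Submodule.restrictScalars_mem]
    exact ⟨fun h b hb => congrFun h ⟨b, hb⟩, fun h => funext fun b => h b b.2⟩
  have hsurj : Function.Surjective ev := fun v => by
    classical
    obtain ⟨f, hf⟩ := hB.exists_eval_eq fun b => if h : b ∈ B then v ⟨b, h⟩ else 0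
    refine ⟨f, funext fun b => ?_⟩
    have := hf b b.2
    rwa [dif_pos b.2] at this
  rw [← (Submodule.Quotient.restrictScalarsEquiv F _).rank_eq,
    ((Submodule.quotEquivOfEq _ _ hker).symm.trans (ev.quotKerEquivOfSurjective hsurj)).rank_eq,
    rank_fun']
  simp

end Closure

/-! ### One conjugacy class: points against right subspaces. -/

section Conjugacy

variable {F : Type u} [DivisionRing F] {n : ℕ} {σ : F →+* Matrix (Fin n) (Fin n) F}
  {δ : SkewDerivation σ}

/-- Scalars that sum to `1` are not all zero, and a nonzero one is a conjugating scalar. -/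
theorem exists_mem_conjClass {B : Finset (Fin n → F)} (hB : IsPIndep δ (B : Set (Fin n → F)))
    {b : Fin n → F} (hb : b ∈ pClosure δ (B : Set (Fin n → F))) :
    ∃ c ∈ B, c ∈ conjClass δ b := by
  obtain ⟨k, hk, h1⟩ := hB.exists_sum_eq_one hb
  obtain ⟨c, -, hc⟩ := Finset.exists_ne_zero_of_sum_ne_zero (h1.trans_ne one_ne_zero)
  exact ⟨c, c.2, k c, hc, eq_conj_of_opD_eq hc (hk c)⟩

theorem pClosure_subset_conjClass {B : Finset (Fin n → F)} {a : Fin n → F}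
    (hB : IsPIndep δ (B : Set (Fin n → F))) (hBa : (B : Set (Fin n → F)) ⊆ conjClass δ a) :
    pClosure δ (B : Set (Fin n → F)) ⊆ conjClass δ a := fun b hb => by
  obtain ⟨c, hc, hcb⟩ := exists_mem_conjClass hB hb
  exact mem_conjClass_trans (hBa hc) (mem_conjClass_symm hcb)

/-- A skew polynomial vanishes on `Ω ⊆ 𝒞(𝐚)` if and only if its operator vanishes on `Ω^𝒟`. -/
theorem mem_vanishingIdeal_iff_toOp {a : Fin n → F} {S : Set (Fin n → F)}
    (hS : S ⊆ conjClass δ a) {f : SkewPoly σ δ} :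
    f ∈ vanishingIdeal δ S ↔ ∀ β ∈ linSpace δ a S, toOp δ a f β = 0 := by
  constructor
  · intro hf β hβ
    induction hβ using Submodule.span_induction with
    | mem β h => rw [toOp_eq_eval_conj_mul a h.1, hf _ h.2, zero_mul]
    | zero => exact map_zero _
    | add β γ _ _ hβ hγ => rw [map_add, hβ, hγ, add_zero]
    | smul k β _ hβ => rw [toOp_op_smul, hβ, smul_zero]
  · intro h b hb
    obtain ⟨β, hβ, rfl⟩ := hS hb
    have h0 := h β (Submodule.subset_span ⟨hβ, hb⟩)
    rw [toOp_eq_eval_conj_mul a hβ] at h0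
    exact (mul_eq_zero.1 h0).resolve_right hβ

/-- Passing to the span adds no points: operators of `I(S)` vanish on the whole span, so the new
conjugates lie in the P-closure of `S`. -/
theorem IsPClosed.eq_conj_linSpace {a : Fin n → F} {S : Set (Fin n → F)} (hcl : IsPClosed δ S)
    (hS : S ⊆ conjClass δ a) : S = {b | ∃ β ∈ linSpace δ a S, β ≠ 0 ∧ b = conj δ a β} := by
  ext b
  constructor
  · intro hb
    obtain ⟨β, hβ, rfl⟩ := hS hb
    exact ⟨β, Submodule.subset_span ⟨hβ, hb⟩, hβ, rfl⟩
  · rintro ⟨β, hV, hβ, rfl⟩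
    rw [← show pClosure δ S = S from hcl]
    intro f hf
    have h0 := (mem_vanishingIdeal_iff_toOp hS).1 hf β hV
    rw [toOp_eq_eval_conj_mul a hβ] at h0
    exact (mul_eq_zero.1 h0).resolve_right hβ

/-- A finite P-basis of `Ω ⊆ 𝒞(𝐚)` yields a basis of `Ω^𝒟` over the centralizer of `𝐚`. -/
theorem IsPBasis.exists_basis_linSpace {a : Fin n → F} {S : Set (Fin n → F)}
    {B : Finset (Fin n → F)} (hB : IsPBasis δ (B : Set (Fin n → F)) S)
    (hS : S ⊆ conjClass δ a) :
    Nonempty (Module.Basis B (↥(centralizer δ a))ᵐᵒᵖ (linSpace δ a S)) := by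
  classical
  have hconj : ∀ c : B, ∃ β : F, β ≠ 0 ∧ (c : Fin n → F) = conj δ a β :=
    fun c => hS (hB.1 c.2)
  choose β hβ hcβ using hconj
  have hop : ∀ c : B, opD δ a (β c) = fun i => (c : Fin n → F) i * β c := fun c => by
    rw [hcβ c]; exact opD_eq_conj_mul a (hβ c)
  choose e he h0 using fun c : B => hB.2.1.exists_dual c.2
  have hli : LinearIndependent (↥(centralizer δ a))ᵐᵒᵖ β := by
    rw [Fintype.linearIndependent_iff]
    intro v hv c
    -- The operator of `e_c` is right linear, fixes `β_c` and kills the other `β_d`, so it isolates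
    -- one coefficient.
    have h : toOp δ a (e c) (∑ d, v d • β d) = 0 := by rw [hv, map_zero]
    rw [map_sum, Finset.sum_eq_single c] at h
    · rw [toOp_op_smul, toOp_eq_eval_mul (hop c), he, one_mul] at h
      exact (smul_eq_zero.1 h).resolve_right (hβ c)
    · intro d _ hd
      rw [toOp_op_smul, toOp_eq_eval_mul (hop d),
        h0 c d d.2 fun h => hd (Subtype.ext h), zero_mul, smul_zero]
    · exact fun h => absurd (Finset.mem_univ _) h
  have hspan : Submodule.span (↥(centralizer δ a))ᵐᵒᵖ (Set.range β) = linSpace δ a S := by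
    apply le_antisymm
    · refine Submodule.span_le.2 ?_
      rintro _ ⟨c, rfl⟩
      exact Submodule.subset_span ⟨hβ c, hcβ c ▸ hB.1 c.2⟩
    · refine Submodule.span_le.2 ?_
      rintro γ ⟨hγ, hγS⟩
      obtain ⟨k, hk, h1⟩ := hB.2.1.exists_sum_eq_one (hB.2.2.ge hγS)
      -- In `γ = ∑ k_c γ`, each nonzero `k_c γ` conjugates `𝐚` to `c`, as `β_c` does, so it lies in
      -- `β_c K_𝐚`.
      rw [← one_mul γ, ← h1, Finset.sum_mul]
      refine Submodule.sum_mem _ fun c _ => ?_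
      have hc : opD δ a (k c * γ) = fun i => (c : Fin n → F) i * (k c * γ) := by
        rw [opD_mul_of_eq (opD_eq_conj_mul a hγ), hk c]
        simp only [mul_assoc]
      obtain ⟨κ, hκ⟩ := exists_op_smul_eq (hβ c) (hop c) hc
      rw [hκ]
      exact Submodule.smul_mem _ _ (Submodule.subset_span ⟨c, rfl⟩)
  exact ⟨(Module.Basis.span hli).map (LinearEquiv.ofEq _ _ hspan)⟩

theorem phi_surjective (a : Fin n → F) : Function.Surjective (phi δ a) := fun T => by
  have hT := T.2
  rw [mem_LinPoly, ← Finsupp.range_linearCombination] at hT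
  obtain ⟨f, hf⟩ := hT
  exact ⟨f, Subtype.ext hf⟩

theorem phi_mem_linIdeal {a : Fin n → F} {S : Set (Fin n → F)} (hS : S ⊆ conjClass δ a)
    {f : SkewPoly σ δ} :
    phi δ a f ∈ linIdeal δ a (linSpace δ a S) ↔ f ∈ vanishingIdeal δ S :=
  (mem_vanishingIdeal_iff_toOp hS).symm

/-- `I(S)` is the preimage of the operator ideal under the surjective ring morphism `φ_𝐚`. -/
theorem isTwoSided_linIdeal_iff {a : Fin n → F} {S : Set (Fin n → F)}
    (hS : S ⊆ conjClass δ a) :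
    (vanishingIdeal δ S).IsTwoSided ↔ (linIdeal δ a (linSpace δ a S)).IsTwoSided := by
  constructor
  · refine fun h => ⟨fun {T} U hT => ?_⟩
    obtain ⟨f, rfl⟩ := phi_surjective a T
    obtain ⟨g, rfl⟩ := phi_surjective a U
    rw [← map_mul (phi δ a), phi_mem_linIdeal hS]
    exact h.mul_mem_of_left g ((phi_mem_linIdeal hS).1 hT)
  · refine fun h => ⟨fun {f} g hf => ?_⟩
    rw [← phi_mem_linIdeal hS, map_mul (phi δ a)]
    exact h.mul_mem_of_left _ ((phi_mem_linIdeal hS).2 hf)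

/-- `F ↦ F^{𝒟_𝐚}` modulo `I(Ω^𝒟)`, as a left linear map. -/
noncomputable def phiQuot (δ : SkewDerivation σ) (a : Fin n → F)
    (V : Submodule (↥(centralizer δ a))ᵐᵒᵖ F) :
    SkewPoly σ δ →ₗ[F] (LinPoly δ a ⧸ linIdeal δ a V) where
  toFun f := Submodule.Quotient.mk (phi δ a f)
  map_add' f g := by rw [map_add]; rfl
  map_smul' c f := by
    have h : phi δ a (c • f) = c • phi δ a f :=
      Subtype.ext (AddMonoidHom.ext fun β => toOp_smul a c f β)
    rw [h]; rfl

theorem exists_quotientEquiv_linIdeal {a : Fin n → F} {S : Set (Fin n → F)}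
    (hS : S ⊆ conjClass δ a) :
    ∃ Ψ : (SkewPoly σ δ ⧸ vanishingIdeal δ S) ≃ₗ[F]
        (LinPoly δ a ⧸ linIdeal δ a (linSpace δ a S)),
      ∀ f, Ψ (Submodule.Quotient.mk f) = Submodule.Quotient.mk (phi δ a f) := by
  have hker : (vanishingIdeal δ S).restrictScalars F =
      LinearMap.ker (phiQuot δ a (linSpace δ a S)) := by
    ext f
    rw [LinearMap.mem_ker, Submodule.restrictScalars_mem, ← phi_mem_linIdeal hS]
    exact (Submodule.Quotient.mk_eq_zero _).symm
  have hsurj : Function.Surjective (phiQuot δ a (linSpace δ a S)) := fun x => by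
    obtain ⟨T, rfl⟩ := Submodule.Quotient.mk_surjective _ x
    obtain ⟨f, rfl⟩ := phi_surjective a T
    exact ⟨f, rfl⟩
  exact ⟨(Submodule.Quotient.restrictScalarsEquiv F _).symm.trans
    ((Submodule.quotEquivOfEq _ _ hker).trans
      (LinearMap.quotKerEquivOfSurjective _ hsurj)), fun f => rfl⟩

/-- If `I(Ω)` is two-sided, then the P-closed set `Ω` is a union of conjugacy classes. -/
theorem IsPClosed.conjClass_subset_of_isTwoSided {Ω : Set (Fin n → F)} (hΩ : IsPClosed δ Ω)
    (h2 : (vanishingIdeal δ Ω).IsTwoSided) {b : Fin n → F} (hb : b ∈ Ω) :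
    conjClass δ b ⊆ Ω := by
  rintro _ ⟨β, hβ, rfl⟩
  rw [← show pClosure δ Ω = Ω from hΩ]
  intro f hf
  -- The value of `f β` at `𝐛` is `f(𝐛^β) β`.
  have h := h2.mul_mem_of_left (C δ β) hf b hb
  rw [eval_eq_toOp, map_mul (toOp δ b), End_mul_apply, toOp_C, mul_one,
    toOp_eq_eval_conj_mul b hβ] at h
  exact (mul_eq_zero.1 h).resolve_right hβ

/-- The vanishing ideal of a conjugacy class is two-sided. -/
theorem isTwoSided_vanishingIdeal_conjClass (a : Fin n → F) :
    (vanishingIdeal δ (conjClass δ a)).IsTwoSided := by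
  -- Every nonzero scalar gives a point of the class, so the ideal is the kernel of a ring morphism.
  have hmem : ∀ f, f ∈ vanishingIdeal δ (conjClass δ a) ↔ toOp δ a f = 0 := fun f => by
    constructor
    · refine fun hf => AddMonoidHom.ext fun β => ?_
      show toOp δ a f β = 0
      rcases eq_or_ne β 0 with rfl | hβ
      · rw [map_zero]
      · rw [toOp_eq_eval_conj_mul a hβ, hf _ ⟨β, hβ, rfl⟩, zero_mul]
    · rintro hf _ ⟨β, hβ, rfl⟩
      have h : toOp δ a f β = 0 := by rw [hf]; rfl
      rw [toOp_eq_eval_conj_mul a hβ] at h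
      exact (mul_eq_zero.1 h).resolve_right hβ
  refine ⟨fun {f} g hf => ?_⟩
  rw [hmem] at hf ⊢
  rw [map_mul (toOp δ a), hf, zero_mul]

end Conjugacy

/-! ### Gluing distinct conjugacy classes. -/

section Decomposition

variable {F : Type u} [DivisionRing F] {n l : ℕ} {σ : F →+* Matrix (Fin n) (Fin n) F}
  {δ : SkewDerivation σ}

theorem vanishingIdeal_iUnion_eq {ι : Type*} (S : ι → Set (Fin n → F)) :
    vanishingIdeal δ (⋃ i, S i) = ⨅ i, vanishingIdeal δ (S i) := by
  ext f
  simp only [mem_vanishingIdeal, Submodule.mem_iInf, Set.mem_iUnion]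
  exact ⟨fun h i a ha => h a ⟨i, ha⟩, fun h a ⟨i, ha⟩ => h i a ha⟩

/-- P-independent sets in distinct conjugacy classes have a P-independent union. -/
theorem isPIndep_biUnion [DecidableEq (Fin n → F)] {a : Fin l → Fin n → F}
    (ha : ∀ i j, i ≠ j → a j ∉ conjClass δ (a i)) {B : Fin l → Finset (Fin n → F)}
    (hBa : ∀ i, (B i : Set (Fin n → F)) ⊆ conjClass δ (a i))
    (hB : ∀ i, IsPIndep δ (B i : Set (Fin n → F))) :
    IsPIndep δ ((Finset.univ.biUnion B : Finset (Fin n → F)) : Set (Fin n → F)) := by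
  intro b hb hcl
  obtain ⟨i, -, hbi⟩ := Finset.mem_biUnion.1 hb
  set U : Finset (Fin n → F) := (Finset.univ.biUnion B).erase b with hU
  rw [← Finset.coe_erase, ← hU] at hcl
  obtain ⟨D, hDU, hD, hDcl⟩ :=
    exists_isPIndep_pClosure_eq (subset_pClosure (δ := δ) (U : Set (Fin n → F)))
  rw [← hDcl] at hcl
  obtain ⟨k, hk, h1⟩ := hD.exists_sum_eq_one hcl
  -- The points with `k_c ≠ 0` are conjugate to `b`, hence lie in `B i`. So `b` is already in the
  -- P-closure of the rest of `B i`.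
  refine hB i b hbi (mem_pClosure_of_sum_eq_one Finset.univ k (fun c => c) ?_
    (fun c _ => hk c) h1)
  intro c _ hc
  have hcU := hDU c.2
  rw [hU, Finset.mem_coe, Finset.mem_erase, Finset.mem_biUnion] at hcU
  obtain ⟨hcb, j, -, hcj⟩ := hcU
  have hcc : (c : Fin n → F) ∈ conjClass δ b := ⟨k c, hc, eq_conj_of_opD_eq hc (hk c)⟩
  have hij : i = j := by
    by_contra hij
    exact ha i j hij (mem_conjClass_trans (mem_conjClass_trans (hBa i hbi) hcc)
      (mem_conjClass_symm (hBa j hcj)))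
  subst hij
  exact ⟨hcj, hcb⟩

/-- Chinese remaindering by interpolating all prescribed values on the P-independent union. -/
theorem exists_forall_sub_mem {a : Fin l → Fin n → F}
    (ha : ∀ i j, i ≠ j → a j ∉ conjClass δ (a i)) {B : Fin l → Finset (Fin n → F)}
    (hBa : ∀ i, (B i : Set (Fin n → F)) ⊆ conjClass δ (a i))
    (hB : ∀ i, IsPIndep δ (B i : Set (Fin n → F))) (f : Fin l → SkewPoly σ δ) :
    ∃ g : SkewPoly σ δ, ∀ i, g - f i ∈ vanishingIdeal δ (B i : Set (Fin n → F)) := by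
  classical
  obtain ⟨g, hg⟩ := (isPIndep_biUnion ha hBa hB).exists_eval_eq fun b =>
    -- The chosen index is the only one, as the classes are disjoint; the value `0` off the union
    -- plays no role.
    if h : ∃ i, b ∈ B i then eval b (f h.choose) else 0
  refine ⟨g, fun i b hb => ?_⟩
  have hex : ∃ i, b ∈ B i := ⟨i, hb⟩
  have hi : hex.choose = i := by
    by_contra hne
    exact ha _ _ hne (mem_conjClass_trans (hBa _ hex.choose_spec)
      (mem_conjClass_symm (hBa i hb)))
  rw [eval_sub, hg b (Finset.mem_biUnion.2 ⟨i, Finset.mem_univ _, hb⟩), dif_pos hex, hi,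
    sub_self]

theorem exists_quotientEquiv_pi {Ω : Set (Fin n → F)} {S : Fin l → Set (Fin n → F)}
    (hΩ : Ω = ⋃ i, S i)
    (hcrt : ∀ f : Fin l → SkewPoly σ δ, ∃ g, ∀ i, g - f i ∈ vanishingIdeal δ (S i)) :
    ∃ Φ : (SkewPoly σ δ ⧸ vanishingIdeal δ Ω) ≃ₗ[SkewPoly σ δ]
        (∀ i, SkewPoly σ δ ⧸ vanishingIdeal δ (S i)),
      ∀ f, Φ (Submodule.Quotient.mk f) = fun _ => Submodule.Quotient.mk f := by
  let q : SkewPoly σ δ →ₗ[SkewPoly σ δ] (∀ i, SkewPoly σ δ ⧸ vanishingIdeal δ (S i)) :=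
    LinearMap.pi fun i => (vanishingIdeal δ (S i)).mkQ
  have hker : vanishingIdeal δ Ω = LinearMap.ker q := by
    rw [LinearMap.ker_pi, hΩ, vanishingIdeal_iUnion_eq]
    simp only [Submodule.ker_mkQ]
  have hsurj : Function.Surjective q := fun x => by
    choose f hf using fun i => Submodule.Quotient.mk_surjective _ (x i)
    obtain ⟨g, hg⟩ := hcrt f
    refine ⟨g, funext fun i => ?_⟩
    rw [← hf i]
    exact (Submodule.Quotient.eq _).2 (hg i)
  exact ⟨(Submodule.quotEquivOfEq _ _ hker).trans
    (LinearMap.quotKerEquivOfSurjective _ hsurj), fun f => rfl⟩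

end Decomposition

end SkewPolys

/-! ### Assembly of the theorem. -/

theorem mainTheorem6 {F : Type u} [DivisionRing F] {n l : ℕ}
    (σ : F →+* Matrix (Fin n) (Fin n) F) (δ : SkewDerivation σ)
    (Ω : Set (Fin n → F)) (hΩ : IsPClosed δ Ω) (hfg : IsPFinGen δ Ω)
    (a : Fin l → Fin n → F) (ha : ∀ i j, i ≠ j → a j ∉ conjClass δ (a i))
    (Ω' : Fin l → Set (Fin n → F)) (hΩ' : ∀ i, Ω' i = Ω ∩ conjClass δ (a i))
    (hne : ∀ i, (Ω' i).Nonempty) (hcover : Ω = ⋃ i, Ω' i)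
    (V : ∀ i, Submodule (↥(centralizer δ (a i)))ᵐᵒᵖ F)
    (hV : ∀ i, V i = linSpace δ (a i) (Ω' i)) :
    -- the pieces are finitely generated P-closed sets, with the expected right vector spaces
    (∀ i, IsPClosed δ (Ω' i) ∧ IsPFinGen δ (Ω' i) ∧
      Module.Finite (↥(centralizer δ (a i)))ᵐᵒᵖ (V i) ∧
      Ω' i = {b | ∃ β ∈ V i, β ≠ 0 ∧ b = conj δ (a i) β}) ∧
    -- the two maps are isomorphisms
    (∃ (Φ : (SkewPoly σ δ ⧸ vanishingIdeal δ Ω) ≃ₗ[SkewPoly σ δ]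
          (∀ i, SkewPoly σ δ ⧸ vanishingIdeal δ (Ω' i)))
        (Ψ : (∀ i, SkewPoly σ δ ⧸ vanishingIdeal δ (Ω' i)) ≃ₗ[F]
          (∀ i, LinPoly δ (a i) ⧸ linIdeal δ (a i) (V i))),
      (∀ f : SkewPoly σ δ,
        Φ (Submodule.Quotient.mk f) = fun _ => Submodule.Quotient.mk f) ∧
      (∀ f : Fin l → SkewPoly σ δ,
        Ψ (fun i => Submodule.Quotient.mk (f i)) =
          fun i => Submodule.Quotient.mk (phi δ (a i) (f i))) ∧
      -- they are left linear over `F` and over the skew polynomial ring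
      (∀ (c : F) x, Φ (c • x) = c • Φ x) ∧
      (∀ (f : SkewPoly σ δ) x i, Ψ (f • x) i = phi δ (a i) f • Ψ x i) ∧
      -- once one of the three ideals or families of ideals is two-sided, all are (so that all
      -- quotients are rings), and the maps are multiplicative
      ((vanishingIdeal δ Ω).IsTwoSided ↔ ∀ i, (vanishingIdeal δ (Ω' i)).IsTwoSided) ∧
      ((vanishingIdeal δ Ω).IsTwoSided ↔ ∀ i, (linIdeal δ (a i) (V i)).IsTwoSided) ∧
      (∀ [(vanishingIdeal δ Ω).IsTwoSided] [∀ i, (vanishingIdeal δ (Ω' i)).IsTwoSided]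
          [∀ i, (linIdeal δ (a i) (V i)).IsTwoSided],
        (∀ x y, Φ (x * y) = Φ x * Φ y) ∧ Φ 1 = 1 ∧
        (∀ x y, Ψ (x * y) = Ψ x * Ψ y) ∧ Ψ 1 = 1)) ∧
    -- the ranks are well defined
    ((∃ B, IsPBasis δ B Ω) ∧ ∀ B, IsPBasis δ B Ω → B.Finite ∧ B.ncard = pRank δ Ω) ∧
    (∀ i, (∃ B, IsPBasis δ B (Ω' i)) ∧
      ∀ B, IsPBasis δ B (Ω' i) → B.Finite ∧ B.ncard = pRank δ (Ω' i)) ∧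
    -- the dimensions, piece by piece and in total
    (∀ i, Module.rank F (LinPoly δ (a i) ⧸ linIdeal δ (a i) (V i)) =
        Module.rank (↥(centralizer δ (a i)))ᵐᵒᵖ (V i) ∧
      Module.rank (↥(centralizer δ (a i)))ᵐᵒᵖ (V i) = (pRank δ (Ω' i) : Cardinal.{u})) ∧
    (∑ i, Module.rank F (LinPoly δ (a i) ⧸ linIdeal δ (a i) (V i)) =
      ∑ i, Module.rank (↥(centralizer δ (a i)))ᵐᵒᵖ (V i)) ∧
    (∑ i, Module.rank (↥(centralizer δ (a i)))ᵐᵒᵖ (V i) =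
      ((∑ i, pRank δ (Ω' i) : ℕ) : Cardinal.{u})) ∧
    (((∑ i, pRank δ (Ω' i) : ℕ) : Cardinal.{u}) =
      Module.rank F (SkewPoly σ δ ⧸ vanishingIdeal δ Ω)) ∧
    (Module.rank F (SkewPoly σ δ ⧸ vanishingIdeal δ Ω) = (pRank δ Ω : Cardinal.{u})) := by
  classical
  obtain rfl : V = fun i => linSpace δ (a i) (Ω' i) := funext hV
  obtain ⟨G, -, hGf, hG⟩ := hfg
  lift G to Finset (Fin n → F) using hGf
  have hsub : ∀ i, Ω' i ⊆ Ω := fun i => hΩ' i ▸ Set.inter_subset_left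
  have hconj : ∀ i, Ω' i ⊆ conjClass δ (a i) := fun i => hΩ' i ▸ Set.inter_subset_right
  choose B hBS hB hBcl using fun i => exists_isPIndep_pClosure_eq ((hsub i).trans hG.ge)
  have hBa : ∀ i, (B i : Set (Fin n → F)) ⊆ conjClass δ (a i) :=
    fun i => (hBS i).trans (hconj i)
  -- The P-closure of a piece stays in `Ω`, which is P-closed, and in the class, because the piece
  -- has a finite P-independent generating set there.
  have hcl : ∀ i, IsPClosed δ (Ω' i) := fun i => by
    refine Set.Subset.antisymm ?_ (subset_pClosure _)
    conv_rhs => rw [hΩ' i]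
    refine Set.subset_inter ?_ ?_
    · exact (pClosure_mono (hsub i)).trans (le_of_eq hΩ)
    · rw [← hBcl i]
      exact pClosure_subset_conjClass (hB i) (hBa i)
  have hbasis : ∀ i, IsPBasis δ (B i : Set (Fin n → F)) (Ω' i) :=
    fun i => ⟨hBS i, hB i, (hBcl i).trans (hcl i)⟩
  have hBI : ∀ i, vanishingIdeal δ (B i : Set (Fin n → F)) = vanishingIdeal δ (Ω' i) :=
    fun i => by rw [← vanishingIdeal_pClosure, (hbasis i).2.2]
  obtain ⟨B₀, hB₀S, hB₀, hB₀cl⟩ := exists_isPIndep_pClosure_eq hG.ge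
  have hbasis₀ : IsPBasis δ (B₀ : Set (Fin n → F)) Ω := ⟨hB₀S, hB₀, hB₀cl.trans hΩ⟩
  have hfin : ∀ {S B}, S ⊆ Ω → IsPBasis δ B S → B.Finite ∧ B.ncard = pRank δ S :=
    fun hS hB' =>
      have hf := hB'.finite (hS.trans hG.ge)
      ⟨hf, hB'.ncard_eq_pRank hf⟩
  have hcard : ∀ i, (B i).card = pRank δ (Ω' i) := fun i => by
    rw [← (hfin (hsub i) (hbasis i)).2, Set.ncard_coe_finset]
  have hcard₀ : B₀.card = pRank δ Ω := by
    rw [← (hfin subset_rfl hbasis₀).2, Set.ncard_coe_finset]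
  have b := fun i => ((hbasis i).exists_basis_linSpace (hconj i)).some
  have hrankV : ∀ i, Module.rank (↥(centralizer δ (a i)))ᵐᵒᵖ (linSpace δ (a i) (Ω' i)) =
      (pRank δ (Ω' i) : Cardinal.{u}) := fun i => by
    rw [rank_eq_card_basis (b i), Fintype.card_coe, hcard]
  have hrankR : ∀ i, Module.rank F (SkewPoly σ δ ⧸ vanishingIdeal δ (Ω' i)) =
      (pRank δ (Ω' i) : Cardinal.{u}) := fun i => by
    rw [← hBI, rank_quotient_vanishingIdeal (hB i), hcard]
  have hrankΩ : Module.rank F (SkewPoly σ δ ⧸ vanishingIdeal δ Ω) =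
      (pRank δ Ω : Cardinal.{u}) := by
    rw [← hcard₀, ← rank_quotient_vanishingIdeal hB₀,
      ← vanishingIdeal_pClosure (B₀ : Set (Fin n → F)),
      hbasis₀.2.2]
  obtain ⟨Φ, hΦ⟩ := exists_quotientEquiv_pi hcover fun f => by
    obtain ⟨g, hg⟩ := exists_forall_sub_mem ha hBa hB f
    exact ⟨g, fun i => hBI i ▸ hg i⟩
  choose ψ hψ using fun i => exists_quotientEquiv_linIdeal (hconj i)
  have hrankL : ∀ i, Module.rank F
      (LinPoly δ (a i) ⧸ linIdeal δ (a i) (linSpace δ (a i) (Ω' i))) =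
      (pRank δ (Ω' i) : Cardinal.{u}) := fun i => by rw [← (ψ i).rank_eq, hrankR]
  have hΦF : ∀ (c : F) x, Φ (c • x) = c • Φ x := fun c x => by
    obtain ⟨f, rfl⟩ := Submodule.Quotient.mk_surjective _ x
    rw [← Submodule.Quotient.mk_smul, hΦ, hΦ]
    rfl
  have hrank_sum : ((∑ i, pRank δ (Ω' i) : ℕ) : Cardinal.{u}) =
      Module.rank F (SkewPoly σ δ ⧸ vanishingIdeal δ Ω) := by
    let ΦF : (SkewPoly σ δ ⧸ vanishingIdeal δ Ω) ≃ₗ[F]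
        (∀ i, SkewPoly σ δ ⧸ vanishingIdeal δ (Ω' i)) := { Φ with map_smul' := hΦF }
    -- Finiteness allows the dimension of the product to be added up in natural numbers.
    have := fun i => Module.finite_of_rank_eq_nat (hrankR i)
    rw [ΦF.rank_eq, ← Module.finrank_eq_rank, Module.finrank_pi_fintype]
    exact congrArg _ (Finset.sum_congr rfl fun i _ =>
      (Module.finrank_eq_of_rank_eq (hrankR i)).symm)
  have h2 : (vanishingIdeal δ Ω).IsTwoSided ↔ ∀ i, (vanishingIdeal δ (Ω' i)).IsTwoSided := by
    constructor
    · intro h i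
      obtain ⟨p, hp⟩ := hne i
      -- A two-sided `I(Ω)` makes `Ω` a union of classes, and the point `p` brings in the whole
      -- class of `𝐚_i`.
      have hclass : Ω' i = conjClass δ (a i) := by
        refine (hconj i).antisymm fun q hq => ?_
        have hqp := mem_conjClass_trans (mem_conjClass_symm (hconj i hp)) hq
        rw [hΩ' i]
        exact ⟨hΩ.conjClass_subset_of_isTwoSided h (hsub i hp) hqp, hq⟩
      rw [hclass]
      exact isTwoSided_vanishingIdeal_conjClass (a i)
    · intro h
      refine ⟨fun {f} g hf => ?_⟩
      rw [hcover, vanishingIdeal_iUnion_eq, Submodule.mem_iInf] at hf ⊢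
      exact fun i => (h i).mul_mem_of_left g (hf i)
  have hΨ : ∀ f : Fin l → SkewPoly σ δ, LinearEquiv.piCongrRight ψ
      (fun i => Submodule.Quotient.mk (f i)) =
        fun i => Submodule.Quotient.mk (phi δ (a i) (f i)) :=
    fun f => funext fun i => hψ i (f i)
  refine ⟨fun i => ⟨hcl i, ⟨B i, hBS i, (B i).finite_toSet, (hbasis i).2.2⟩,
      Module.Finite.of_basis (b i), (hcl i).eq_conj_linSpace (hconj i)⟩,
    ⟨Φ, LinearEquiv.piCongrRight ψ, hΦ, hΨ, hΦF, ?_, h2,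
      h2.trans (forall_congr' fun i => isTwoSided_linIdeal_iff (hconj i)), ?_⟩,
    ⟨⟨_, hbasis₀⟩, fun _ h => hfin subset_rfl h⟩,
    fun i => ⟨⟨_, hbasis i⟩, fun _ h => hfin (hsub i) h⟩,
    fun i => ⟨(hrankL i).trans (hrankV i).symm, hrankV i⟩,
    Finset.sum_congr rfl fun i _ => (hrankL i).trans (hrankV i).symm, ?_, hrank_sum, hrankΩ⟩
  · intro f x i
    obtain ⟨g, hg⟩ := Submodule.Quotient.mk_surjective _ (x i)
    rw [LinearEquiv.piCongrRight_apply, LinearEquiv.piCongrRight_apply, Pi.smul_apply, ← hg,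
      ← Submodule.Quotient.mk_smul, hψ, hψ, smul_eq_mul, map_mul (phi δ (a i))]
    rfl
  · intro _ _ _
    refine ⟨fun x y => ?_, hΦ 1, fun x y => ?_, ?_⟩
    · obtain ⟨f, rfl⟩ := Submodule.Quotient.mk_surjective _ x
      obtain ⟨g, rfl⟩ := Submodule.Quotient.mk_surjective _ y
      rw [hΦ, hΦ]
      exact hΦ (f * g)
    · choose f hf using fun i => Submodule.Quotient.mk_surjective _ (x i)
      choose g hg using fun i => Submodule.Quotient.mk_surjective _ (y i)
      obtain rfl : (fun i => Submodule.Quotient.mk (f i)) = x := funext hf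
      obtain rfl : (fun i => Submodule.Quotient.mk (g i)) = y := funext hg
      rw [hΨ, hΨ]
      refine (hΨ fun i => f i * g i).trans (funext fun i => ?_)
      rw [map_mul (phi δ (a i))]
      rfl
    · refine (hΨ fun _ => 1).trans (funext fun i => ?_)
      rw [map_one (phi δ (a i))]
      rfl
  · rw [Nat.cast_sum]
    exact Finset.sum_congr rfl fun i _ => hrankV i
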